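/- Let $K$ be a number field whose ring of integers $\mathcal{O}_K$ is a principal ideal domain, and let $\widehat{\mathcal{O}_K}$ be the topos of presheaves of sets on the category with one object $\star$ whose arrows are the elements of $\mathcal{O}_K$, composed by multiplication. A point of $\widehat{\mathcal{O}_K}$ is a geometric morphism $p$ from the topos of sets to $\widehat{\mathcal{O}_K}$; two points are isomorphic if their inverse image functors are naturally isomorphic. Let $F_p\colon \mathcal{O}_K\to \mathrm{Sets}$ be the covariant (flat) functor obtained by restricting the inverse image functor $p^*$ along the Yoneda embedding. Call $p$ non-trivial if $F_p(\star)$ has more than one element. For a sub-$\mathcal{O}_K$-module $H$ of $K$ let $F_H$ be the functor sending $\star$ to $H$ and $r\in\mathcal{O}_K$ to multiplication by $r$ on $H$. Let $\mathbb{A}^f_K$ be the ring of finite adeles of $K$, let $\mathfrak{D}=\{x\in K : \mathrm{tr}_{K/\mathbb{Q}}(x\,\mathcal{O}_K)\subseteq\mathbb{Z}\}$, and let $\widehat{\mathfrak{D}}=\prod_{\mathfrak p}\mathcal{O}_{\mathfrak p}\mathfrak{D}\subseteq\mathbb{A}^f_K$ be its profinite completion. For $a\in\mathbb{A}^f_K$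 put $H_a=\{q\in K : aq\in\widehat{\mathfrak{D}}\}$, a sub-$\mathcal{O}_K$-module of $K$. Then there is a (necessarily unique) bijection $$\Phi\colon\ \mathbb{A}^f_K\big/\big(K^{*}\cdot\textstyle\prod_{\mathfrak p}\mathcal{O}_{\mathfrak p}^{*}\big)\ \longrightarrow\ \{\text{isomorphism classes of non-trivial points of }\widehat{\mathcal{O}_K}\}$$ such that, for every $a\in\mathbb{A}^f_K$ and every non-trivial point $p$, the image under $\Phi$ of the class of $a$ is the class of $p$ if and only if $F_p\cong F_{H_a}$. Moreover, trivial points exist, and any two trivial points are isomorphic. -/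

import Mathlib

open CategoryTheory IsDedekindDomain NumberField

noncomputable section

namespace OKTopos

universe u v w

/-! ### Points of a topos -/

/-- A point of a topos `E`: a geometric morphism from the topos of sets to `E`, that is, an inverse
image functor `E ⥤ Set` preserving finite limits, together with a right adjoint (direct image). -/
structure ToposPoint (E : Type v) [Category.{u} E] where
  /-- the inverse image functor -/
  inverseImage : E ⥤ Type w
  /-- the direct image functor -/
  directImage : Type w ⥤ E
  /-- the adjunction between inverse and direct image -/
  adj : inverseImage ⊣ directImage
  /-- the inverse image functor is left exact -/
  leftExact : Limits.PreservesFiniteLimits inverseImage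

/-- Isomorphism of points. Morphisms of points are natural transformations between inverse
images, so two points are isomorphic iff their inverse image functors are. -/
instance ToposPoint.isoSetoid (E : Type v) [Category.{u} E] : Setoid (ToposPoint.{u, v, w} E) where
  r p q := Nonempty (p.inverseImage ≅ q.inverseImage)
  iseqv :=
    { refl := fun _ => ⟨Iso.refl _⟩
      symm := fun ⟨e⟩ => ⟨e.symm⟩
      trans := fun ⟨e⟩ ⟨f⟩ => ⟨e ≪≫ f⟩ }

/-! ### The topos of `𝓞 K`-sets and its points -/

variable (K : Type u) [Field K] [NumberField K]

/-- The topos of presheaves of sets on the category with one object whose arrows are the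
elements of `𝓞 K`, composed by multiplication. -/
abbrev OKSets : Type (u + 1) := (SingleObj (𝓞 K))ᵒᵖ ⥤ Type u

/-- The points of the topos of `𝓞 K`-sets. -/
abbrev Point : Type (u + 1) := ToposPoint.{u, u + 1, u} (OKSets K)

variable {K}

/-- The covariant (flat) functor associated with a point: the restriction of its inverse image
functor along the Yoneda embedding. -/
def Point.flatFunctor (p : Point K) : SingleObj (𝓞 K) ⥤ Type u :=
  yoneda ⋙ p.inverseImage

/-- A point is non-trivial if the set underlying its flat functor (an `𝓞 K`-module, hence
never empty) is not reduced to its zero element. -/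
def Point.IsNontrivial (p : Point K) : Prop :=
  Nontrivial (p.flatFunctor.obj (SingleObj.star (𝓞 K)))

/-- The covariant functor sending the unique object to `H` and the arrow `r` to
multiplication by `r`. -/
def moduleFunctor (H : Submodule (𝓞 K) K) : SingleObj (𝓞 K) ⥤ Type u :=
  actionAsFunctor (𝓞 K) H

variable (K)

/-- Isomorphism of non-trivial points. -/
instance nontrivialPointSetoid : Setoid {p : Point K // p.IsNontrivial} :=
  (ToposPoint.isoSetoid (OKSets K)).comap Subtype.val

/-- The isomorphism classes of non-trivial points of the topos of `𝓞 K`-sets. -/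
abbrev NontrivialPointClass : Type (u + 1) := Quotient (nontrivialPointSetoid K)

variable {K}

/-- The isomorphism class of a non-trivial point. -/
def NontrivialPointClass.mk (p : Point K) (hp : p.IsNontrivial) : NontrivialPointClass K :=
  Quotient.mk (nontrivialPointSetoid K) ⟨p, hp⟩

variable (K)

/-! ### Finite adeles -/

/-- The subgroup `∏_𝔭 𝓞_𝔭ˣ` of the group of units of the ring of finite adeles. -/
def integralUnits : Subgroup (FiniteAdeleRing (𝓞 K) K)ˣ where
  carrier := {x | ∀ 𝔭 : HeightOneSpectrum (𝓞 K),
    (x : FiniteAdeleRing (𝓞 K) K) 𝔭 ∈ 𝔭.adicCompletionIntegers K ∧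
    ((x⁻¹ : (FiniteAdeleRing (𝓞 K) K)ˣ) : FiniteAdeleRing (𝓞 K) K) 𝔭 ∈
      𝔭.adicCompletionIntegers K}
  one_mem' 𝔭 := by
    rw [inv_one]
    exact ⟨one_mem (𝔭.adicCompletionIntegers K), one_mem (𝔭.adicCompletionIntegers K)⟩
  mul_mem' {x y} hx hy 𝔭 := by
    rw [mul_inv]
    exact ⟨mul_mem (hx 𝔭).1 (hy 𝔭).1, mul_mem (hx 𝔭).2 (hy 𝔭).2⟩
  inv_mem' {x} hx 𝔭 := by
    rw [inv_inv]
    exact ⟨(hx 𝔭).2, (hx 𝔭).1⟩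

/-- The subgroup `Kˣ · ∏_𝔭 𝓞_𝔭ˣ` of the group of units of the ring of finite adeles. -/
def adelicGroup : Subgroup (FiniteAdeleRing (𝓞 K) K)ˣ :=
  (FiniteAdeleRing.unitEmbedding (𝓞 K) K).range ⊔ integralUnits K

/-- The quotient of the finite adeles by the multiplication action of `Kˣ · ∏_𝔭 𝓞_𝔭ˣ`. -/
abbrev AdelicQuotient : Type u :=
  MulAction.orbitRel.Quotient (adelicGroup K) (FiniteAdeleRing (𝓞 K) K)

variable {K}

/-- The class of a finite adele. -/
def AdelicQuotient.mk (a : FiniteAdeleRing (𝓞 K) K) : AdelicQuotient K :=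
  Quotient.mk (MulAction.orbitRel (adelicGroup K) (FiniteAdeleRing (𝓞 K) K)) a

variable (K)

/-- Dedekind's complementary module `{x ∈ K | tr (x 𝓞_K) ⊆ ℤ}`. -/
def complementaryModule : Submodule (𝓞 K) K := Submodule.traceDual ℤ ℚ 1

/-- The profinite completion `∏_𝔭 𝓞_𝔭 𝔇` of the complementary module `𝔇`, inside the finite
adeles. -/
def complementaryCompletion : Submodule (𝓞 K) (FiniteAdeleRing (𝓞 K) K) where
  carrier := {x | ∀ 𝔭 : HeightOneSpectrum (𝓞 K),
    x 𝔭 ∈ Submodule.span (𝔭.adicCompletionIntegers K)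
      ((fun q : K => (q : 𝔭.adicCompletion K)) '' (complementaryModule K : Set K))}
  zero_mem' 𝔭 := Submodule.zero_mem _
  add_mem' hx hy 𝔭 := Submodule.add_mem _ (hx 𝔭) (hy 𝔭)
  smul_mem' r x hx 𝔭 := by
    have h := Submodule.smul_mem _ (algebraMap (𝓞 K) (𝔭.adicCompletionIntegers K) r) (hx 𝔭)
    exact h

variable {K}

/-- The `𝓞 K`-submodule `H_a = {q ∈ K | a q ∈ 𝔇̂}` of `K` attached to a finite adele `a`, where
`𝔇̂` is the profinite completion of the complementary module. -/
def adelicModule (a : FiniteAdeleRing (𝓞 K) K) : Submodule (𝓞 K) K where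
  carrier := {q | a * algebraMap K (FiniteAdeleRing (𝓞 K) K) q ∈ complementaryCompletion K}
  zero_mem' := by
    change a * algebraMap K (FiniteAdeleRing (𝓞 K) K) 0 ∈ complementaryCompletion K
    rw [map_zero, mul_zero]
    exact Submodule.zero_mem _
  add_mem' {x y} hx hy := by
    change a * algebraMap K (FiniteAdeleRing (𝓞 K) K) (x + y) ∈ complementaryCompletion K
    rw [map_add, mul_add]
    exact Submodule.add_mem _ hx hy
  smul_mem' r x hx := by
    change a * algebraMap K (FiniteAdeleRing (𝓞 K) K) (r • x) ∈ complementaryCompletion K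
    rw [Algebra.algebraMap_eq_smul_one, smul_assoc, ← Algebra.algebraMap_eq_smul_one,
      mul_smul_comm]
    exact Submodule.smul_mem _ r hx

end OKTopos

end

/-!
By Diaconescu's theorem, points of the topos of presheaves on the one-object category of `𝓞 K` are
flat functors on it, that is, sets `X` with an action of the monoid `𝓞 K` whose category of elements
is cofiltered. Only the following parts are needed: the restriction of an inverse image to
representables is flat (`isCofiltered_elements_yoneda_comp`), a flat functor extends to a point
(`ToposPoint.ofIsCofiltered`), and an inverse image, being cocontinuous, is determined by its
restriction to representables (`nonempty_iso_of_yoneda_comp_iso`).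

A flat action is very rigid: any two elements are multiples of a common one, and an equation
`r • x = s • x` with `r ≠ s` forces `x` to be the unique element fixed by `0`. So if `X` has a
nonzero element `x₀`, then sending `x = r • z`, where `x₀ = s • z`, to `r / s` identifies `X` with a nonzero
submodule of `K` (`exists_submodule_equiv`). Conversely, when `𝓞 K` is principal, two elements of a
submodule of `K` lie in a common cyclic submodule, so that every submodule is flat
(`isCofiltered_elements_submodule`). Isomorphisms between nonzero submodules are multiplications by
elements of `Kˣ` (`nonempty_submodule_iso_iff`).

The complementary module is generated by some `δ ≠ 0`, so that `H_a` consists of the `q ∈ K` with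
`v_𝔭 (a_𝔭 q) ≤ v_𝔭 (δ)` for every `𝔭`, valuations being written multiplicatively. A nonzero
submodule `H` of `K` is determined by its localizations, hence by the supremum (possibly infinite) of each
`v_𝔭` on it, and these suprema are realized by a finite adele: `H = H_a` for some `a`
(`exists_adelicModule_eq`). Conversely `H_a` determines each `v_𝔭 (a_𝔭)`
(`valued_le_of_adelicModule_le`), that is, it determines `a` up to `∏ 𝓞_𝔭ˣ` (`exists_unit_mul_eq`).
As multiplying `a` by an element of `Kˣ` multiplies `H_a` by its inverse, isomorphism classes of the
modules `H_a` are the orbits of `Kˣ · ∏ 𝓞_𝔭ˣ`.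
-/

noncomputable section

namespace OKTopos

universe u v w

/-! ### Points of a presheaf topos and flat functors -/

open Limits Opposite

section General

variable {C : Type v} [Category.{u} C]

/-- The co-Yoneda lemma on elements: since every presheaf is a colimit of representables, every
element of the value of a cocontinuous functor comes from a representable presheaf. -/
lemma exists_map_yoneda_eq (L : (Cᵒᵖ ⥤ Type u) ⥤ Type w) [L.IsLeftAdjoint]
    (P : Cᵒᵖ ⥤ Type u) (x : L.obj P) :
    ∃ (X : C) (φ : yoneda.obj X ⟶ P) (z : L.obj (yoneda.obj X)), L.map φ z = x := by
  obtain ⟨j, z, hz⟩ := Types.jointly_surjective_of_isColimit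
    (isColimitOfPreserves L (Presheaf.isColimitTautologicalCocone P)) x
  exact ⟨j.left, j.hom, z, hz⟩

/-- The restriction to representables of a left exact cocontinuous functor on presheaves is flat. -/
lemma isCofiltered_elements_yoneda_comp (L : (Cᵒᵖ ⥤ Type u) ⥤ Type u) [L.IsLeftAdjoint]
    [PreservesFiniteLimits L] : IsCofiltered (yoneda ⋙ L).Elements := by
  have hne : Nonempty (yoneda ⋙ L).Elements := by
    let t := (IsTerminal.isTerminalObj L _ (terminalIsTerminal (C := Cᵒᵖ ⥤ Type u))).from PUnit
    obtain ⟨X, -, z, -⟩ := exists_map_yoneda_eq L _ (t PUnit.unit)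
    exact ⟨⟨X, z⟩⟩
  have hor : IsCofilteredOrEmpty (yoneda ⋙ L).Elements := by
    constructor
    -- lift the element `(x, y)` of `L (X × Y)` to a representable presheaf
    · rintro ⟨X, x⟩ ⟨Y, y⟩
      let h := mapIsLimitOfPreservesOfIsLimit L _ _
        (prodIsProd (yoneda.obj X) (yoneda.obj Y))
      obtain ⟨l, h₁, h₂⟩ := BinaryFan.IsLimit.lift' h (W := PUnit.{u + 1})
        (↾fun _ => x) (↾fun _ => y)
      obtain ⟨Z, φ, z, hz⟩ := exists_map_yoneda_eq L _ (l PUnit.unit)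
      obtain ⟨f, hf⟩ := yoneda.map_surjective (φ ≫ prod.fst)
      obtain ⟨g, hg⟩ := yoneda.map_surjective (φ ≫ prod.snd)
      refine ⟨⟨Z, z⟩, ⟨f, ?_⟩, ⟨g, ?_⟩, trivial⟩
      · change L.map (yoneda.map f) z = _
        rw [hf, L.map_comp]
        exact (congrArg (L.map prod.fst) hz).trans (ConcreteCategory.congr_hom h₁ PUnit.unit)
      · change L.map (yoneda.map g) z = _
        rw [hg, L.map_comp]
        exact (congrArg (L.map prod.snd) hz).trans (ConcreteCategory.congr_hom h₂ PUnit.unit)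
    -- `x` lies in the value of `L` at the equalizer of `f` and `g`: lift it from there
    · rintro ⟨X, x⟩ ⟨Y, y⟩ ⟨f, hf⟩ ⟨g, hg⟩
      let h := isLimitOfHasEqualizerOfPreservesLimit L (yoneda.map f) (yoneda.map g)
      obtain ⟨l, hl⟩ := Fork.IsLimit.lift' h (W := PUnit.{u + 1}) (↾fun _ => x) (by
        ext
        exact hf.trans hg.symm)
      obtain ⟨Z, φ, z, hz⟩ := exists_map_yoneda_eq L _ (l PUnit.unit)
      obtain ⟨k, hk⟩ := yoneda.map_surjective (φ ≫ equalizer.ι _ _)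
      refine ⟨⟨Z, z⟩, ⟨k, ?_⟩, ?_⟩
      · change L.map (yoneda.map k) z = _
        rw [hk, L.map_comp]
        exact (congrArg (L.map (equalizer.ι _ _)) hz).trans
          (ConcreteCategory.congr_hom hl PUnit.unit)
      · ext1
        apply yoneda.map_injective
        change yoneda.map (k ≫ f) = yoneda.map (k ≫ g)
        simp only [Functor.map_comp, hk, Category.assoc]
        exact congrArg (φ ≫ ·) (equalizer.condition _ _)
  exact { hor with nonempty := hne }

/-- A flat functor, regarded as a point of the site whose topology is trivial. -/
def sitePointOfIsCofiltered (F : C ⥤ Type u) [IsCofiltered F.Elements]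
    [InitiallySmall.{u} F.Elements] :
    GrothendieckTopology.Point.{u} (⊥ : GrothendieckTopology C) where
  fiber := F
  jointly_surjective {U} R hR x := by
    obtain rfl : R = ⊤ := by simpa using hR
    exact ⟨U, 𝟙 _, by simp, x, by simp⟩

/-- The point of the presheaf topos attached to a flat functor `F`: its inverse image is the colimit
over the category of elements of `F`, which is left exact because this category is cofiltered. -/
def ToposPoint.ofIsCofiltered (F : C ⥤ Type u) [IsCofiltered F.Elements]
    [InitiallySmall.{u} F.Elements] :
    ToposPoint.{max u v, max u v (u + 1), u} (Cᵒᵖ ⥤ Type u) where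
  inverseImage := (sitePointOfIsCofiltered F).presheafFiber
  directImage := (sitePointOfIsCofiltered F).skyscraperPresheafFunctor
  adj := (sitePointOfIsCofiltered F).skyscraperPresheafAdjunction
  leftExact := inferInstance

/-- The inverse image of the point attached to a flat functor `F` extends `F`. -/
def ToposPoint.yonedaCompOfIsCofilteredIso (F : C ⥤ Type u) [IsCofiltered F.Elements]
    [InitiallySmall.{u} F.Elements] :
    yoneda ⋙ (ToposPoint.ofIsCofiltered F).inverseImage ≅ F :=
  Functor.isoWhiskerRight shrinkYonedaIsoYoneda.symm _ ≪≫
    (sitePointOfIsCofiltered F).shrinkYonedaCompPresheafFiberIso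

end General

/-- Cocontinuous functors on presheaves are determined by their restriction to representables. -/
lemma nonempty_iso_of_yoneda_comp_iso {M : Type u} [Monoid M]
    (L N : ((SingleObj M)ᵒᵖ ⥤ Type u) ⥤ Type u)
    [L.IsLeftAdjoint] [N.IsLeftAdjoint] (e : yoneda ⋙ L ≅ yoneda ⋙ N) : Nonempty (L ≅ N) := by
  let e' : uliftYoneda.{u} ⋙ N ≅ uliftYoneda.{u} ⋙ L :=
    Functor.isoWhiskerRight uliftYonedaIsoYoneda.{u} N ≪≫ e.symm ≪≫
      (Functor.isoWhiskerRight uliftYonedaIsoYoneda.{u} L).symm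
  exact ⟨Presheaf.uniqueExtensionAlongULiftYoneda.{u} L e' ≪≫
    (Presheaf.uniqueExtensionAlongULiftYoneda.{u} N (Iso.refl _)).symm⟩

/-! ### Flat actions of a commutative domain -/

/-- The action on the set underlying a functor on a one-object category. -/
@[reducible]
def functorMulAction {M : Type v} [Monoid M] (F : SingleObj M ⥤ Type u) :
    MulAction M (F.obj (SingleObj.star M)) where
  smul r x := F.map (X := SingleObj.star M) (Y := SingleObj.star M) r x
  one_smul x := ConcreteCategory.congr_hom (F.map_id (SingleObj.star M)) x
  mul_smul r s x := ConcreteCategory.congr_hom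
    (F.map_comp (X := SingleObj.star M) (Y := SingleObj.star M) (Z := SingleObj.star M) s r) x

/-- A functor on a one-object category is the functor of its action. -/
def isoActionAsFunctor {M : Type v} [Monoid M] (F : SingleObj M ⥤ Type u) :
    letI := functorMulAction F
    F ≅ actionAsFunctor M (F.obj (SingleObj.star M)) :=
  letI := functorMulAction F
  NatIso.ofComponents (fun _ => Iso.refl _) (fun _ => rfl)

lemma nonempty_actionAsFunctor_iso_iff {M : Type v} [Monoid M] {X Y : Type u} [MulAction M X]
    [MulAction M Y] : Nonempty (actionAsFunctor M X ≅ actionAsFunctor M Y) ↔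
      ∃ e : X ≃ Y, ∀ (r : M) (x : X), e (r • x) = r • e x := by
  constructor
  · rintro ⟨i⟩
    refine ⟨(i.app (SingleObj.star M)).toEquiv, fun r x => ?_⟩
    exact ConcreteCategory.congr_hom
      (i.hom.naturality (X := SingleObj.star M) (Y := SingleObj.star M) r) x
  · rintro ⟨e, he⟩
    refine ⟨NatIso.ofComponents (fun _ => e.toIso) fun {_ _} r => ?_⟩
    ext x
    exact he r x

/-- Flatness of an action, spelled out. -/
lemma isCofiltered_elements_actionAsFunctor_iff {M : Type v} [Monoid M] {X : Type u}
    [MulAction M X] : IsCofiltered (actionAsFunctor M X).Elements ↔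
      Nonempty X ∧ (∀ x y : X, ∃ (z : X) (r s : M), r • z = x ∧ s • z = y) ∧
        ∀ (x : X) (r s : M), r • x = s • x → ∃ (z : X) (t : M), t • z = x ∧ r * t = s * t := by
  constructor
  · intro h
    refine ⟨?_, fun x y => ?_, fun x r s hrs => ?_⟩
    · obtain ⟨_, x⟩ := h.nonempty
      exact ⟨x⟩
    · obtain ⟨⟨_, z⟩, r, s, -⟩ := h.cone_objs ⟨SingleObj.star M, x⟩ ⟨SingleObj.star M, y⟩
      exact ⟨z, r.1, s.1, r.2, s.2⟩
    · obtain ⟨⟨_, z⟩, t, ht⟩ := h.cone_maps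
        (X := ⟨SingleObj.star M, x⟩) (Y := ⟨SingleObj.star M, s • x⟩) ⟨r, hrs⟩ ⟨s, rfl⟩
      exact ⟨z, t.1, t.2, congrArg Subtype.val ht⟩
  · rintro ⟨⟨x⟩, h₁, h₂⟩
    exact
      { nonempty := ⟨⟨SingleObj.star M, x⟩⟩
        cone_objs := by
          rintro ⟨_, x⟩ ⟨_, y⟩
          obtain ⟨z, r, s, hr, hs⟩ := h₁ x y
          exact ⟨⟨SingleObj.star M, z⟩, ⟨r, hr⟩, ⟨s, hs⟩, trivial⟩
        cone_maps := by
          rintro ⟨_, x⟩ ⟨_, y⟩ ⟨r, hr⟩ ⟨s, hs⟩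
          obtain ⟨z, t, ht, h⟩ := h₂ x r s (hr.trans hs.symm)
          exact ⟨⟨SingleObj.star M, z⟩, ⟨t, ht⟩, Subtype.ext h⟩ }

instance {M : Type u} [Monoid M] (F : SingleObj M ⥤ Type u) : InitiallySmall.{u} F.Elements :=
  haveI : Small.{u} F.Elements := inferInstanceAs
    (Small.{u} (Σ _ : Unit, F.obj (SingleObj.star M)))
  initiallySmall_of_essentiallySmall _

lemma isCofiltered_elements_of_iso {C : Type v} [Category.{w} C] {F G : C ⥤ Type u}
    (e : F ≅ G) [h : IsCofiltered F.Elements] : IsCofiltered G.Elements :=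
  haveI : IsCofiltered (Functor.elementsFunctor.obj F) := h
  IsCofiltered.of_equivalence (Cat.equivOfIso (Functor.elementsFunctor.mapIso e))

section Domain

variable {R : Type v} [CommRing R] [IsDomain R] {K : Type u} [Field K] [Algebra R K]
  [IsFractionRing R K]

/-- Submodules of the fraction field of a principal ideal domain are flat: two elements lie in a
common cyclic submodule. -/
lemma isCofiltered_elements_submodule [IsPrincipalIdealRing R] (H : Submodule R K) :
    IsCofiltered (actionAsFunctor R H).Elements := by
  rw [isCofiltered_elements_actionAsFunctor_iff]
  refine ⟨⟨0⟩, fun x y => ?_, fun x r s h => ?_⟩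
  · classical
    obtain ⟨d, hd⟩ := IsLocalization.exist_integer_multiples_of_finset (nonZeroDivisors R)
      ({(x : K), (y : K)} : Finset K)
    obtain ⟨a, ha⟩ := hd x (by simp)
    obtain ⟨b, hb⟩ := hd y (by simp)
    have hd0 : (d : R) ≠ 0 := nonZeroDivisors.ne_zero d.2
    obtain ⟨g, hg⟩ := (IsPrincipalIdealRing.principal (Ideal.span {a, b})).principal
    rw [Ideal.submodule_span_eq] at hg
    obtain ⟨m, n, hmn⟩ := Ideal.mem_span_pair.1 (hg ▸ Ideal.mem_span_singleton_self g)
    obtain ⟨a', ha'⟩ := Ideal.mem_span_singleton.1 (hg ▸ Ideal.mem_span_pair.2 ⟨1, 0, by simp⟩ :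
      a ∈ Ideal.span {g})
    obtain ⟨b', hb'⟩ := Ideal.mem_span_singleton.1 (hg ▸ Ideal.mem_span_pair.2 ⟨0, 1, by simp⟩ :
      b ∈ Ideal.span {g})
    have hz : (d : R) • ((m • x + n • y : H) : K) = algebraMap R K g := by
      rw [← hmn, map_add, map_mul, map_mul, ha, hb]
      simp only [Submodule.coe_add, Submodule.coe_smul, Algebra.smul_def]
      ring
    refine ⟨m • x + n • y, a', b', ?_, ?_⟩
    · ext
      apply smul_right_injective K hd0
      dsimp only
      rw [Submodule.coe_smul, smul_comm, hz, ← ha, ha', Algebra.smul_def, ← map_mul, mul_comm]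
    · ext
      apply smul_right_injective K hd0
      dsimp only
      rw [Submodule.coe_smul, smul_comm, hz, ← hb, hb', Algebra.smul_def, ← map_mul, mul_comm]
  · by_cases hx : x = 0
    · exact ⟨0, 0, by simp [hx], by simp⟩
    · exact ⟨x, 1, one_smul _ _, by rw [smul_left_injective R hx h]⟩

/-- A flat action of a domain with more than one element is the multiplication action on a nonzero
submodule of the fraction field: having chosen a nonzero `x₀`, an element `x` for which
`x = r • z` and `x₀ = s • z` corresponds to the fraction `r / s`. -/
theorem exists_submodule_equiv {X : Type w} [MulAction R X] [Nontrivial X]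
    (h : IsCofiltered (actionAsFunctor R X).Elements) :
    ∃ H : Submodule R K, H ≠ ⊥ ∧ ∃ e : X ≃ H, ∀ (r : R) (x : X), e (r • x) = r • e x := by
  rw [isCofiltered_elements_actionAsFunctor_iff] at h
  obtain ⟨-, h₁, h₂⟩ := h
  have hzero (x y : X) : (0 : R) • x = (0 : R) • y := by
    obtain ⟨z, r, s, rfl, rfl⟩ := h₁ x y
    rw [smul_smul, smul_smul, zero_mul, zero_mul]
  -- the elements other than the common value of the `0 • y` are the nonzero ones
  obtain ⟨x₀, hx₀⟩ : ∃ x₀ : X, ∀ y : X, (0 : R) • y ≠ x₀ := by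
    obtain ⟨x, y, hxy⟩ := exists_pair_ne X
    by_contra! hc
    obtain ⟨a, rfl⟩ := hc x
    obtain ⟨b, rfl⟩ := hc y
    exact hxy (hzero a b)
  -- scalars act freely on an element with `x₀` among its multiples
  have hfree (w : X) (c : R) (hw : c • w = x₀) (r s : R) (hrs : r • w = s • w) : r = s := by
    obtain ⟨z, t, rfl, ht⟩ := h₂ w r s hrs
    have ht0 : t ≠ 0 := by
      rintro rfl
      exact hx₀ z (by rw [← hw, smul_smul, mul_zero])
    exact mul_right_cancel₀ ht0 ht
  have hne (w : X) (s : R) (hw : s • w = x₀) : algebraMap R K s ≠ 0 := by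
    rw [Ne, FaithfulSMul.algebraMap_eq_zero_iff]
    rintro rfl
    exact hx₀ w hw
  choose z num den hnum hden using fun x => h₁ x x₀
  let f : X → K := fun x => algebraMap R K (num x) / algebraMap R K (den x)
  -- the fraction does not depend on the choice of `z`
  have hf (x w : X) (r s : R) (hr : r • w = x) (hs : s • w = x₀) :
      f x = algebraMap R K r / algebraMap R K s := by
    obtain ⟨y, a, b, ha, hb⟩ := h₁ (z x) w
    have hy : (den x * a) • y = x₀ := by rw [mul_smul, ha, hden]
    have e₁ : den x * a = s * b := hfree y _ hy _ _ (by
      rw [hy, mul_smul, hb, hs])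
    have e₂ : num x * a = r * b := hfree y _ hy _ _ (by
      rw [mul_smul, mul_smul, ha, hb, hnum, hr])
    have ha0 : a ≠ 0 := by
      rintro rfl
      exact hx₀ y (by rw [← hy, mul_zero])
    rw [div_eq_div_iff (hne _ _ (hden x)) (hne _ _ hs), ← map_mul, ← map_mul]
    congr 1
    apply mul_right_cancel₀ ha0
    linear_combination s * e₂ - r * e₁
  have hfs (r : R) (x : X) : f (r • x) = r • f x := by
    rw [hf (r • x) (z x) (r * num x) (den x) (by rw [mul_smul, hnum]) (hden x), map_mul,
      Algebra.smul_def, mul_div_assoc]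
  have hfinj : Function.Injective f := by
    intro x y hxy
    obtain ⟨w, a, b, ha, hb⟩ := h₁ x y
    obtain ⟨v, c, s, hc, hs⟩ := h₁ w x₀
    have hx := hf x v (a * c) s (by rw [mul_smul, hc, ha]) hs
    have hy := hf y v (b * c) s (by rw [mul_smul, hc, hb]) hs
    rw [hx, hy, div_left_inj' (hne _ _ hs), (FaithfulSMul.algebraMap_injective R K).eq_iff] at hxy
    rw [← ha, ← hb, ← hc, smul_smul, smul_smul, hxy]
  let H : Submodule R K :=
    { carrier := Set.range f
      zero_mem' := ⟨(0 : R) • x₀, by rw [hfs, zero_smul]⟩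
      add_mem' := by
        rintro _ _ ⟨x, rfl⟩ ⟨y, rfl⟩
        obtain ⟨w, a, b, ha, hb⟩ := h₁ x y
        refine ⟨(a + b) • w, ?_⟩
        rw [hfs, add_smul, ← hfs, ← hfs, ha, hb]
      smul_mem' := by
        rintro r _ ⟨x, rfl⟩
        exact ⟨r • x, hfs r x⟩ }
  refine ⟨H, fun hbot => ?_, Equiv.ofInjective f hfinj, fun r x => Subtype.ext (hfs r x)⟩
  have : f x₀ ∈ H := ⟨x₀, rfl⟩
  rw [hbot, Submodule.mem_bot, hf x₀ x₀ 1 1 (one_smul _ _) (one_smul _ _)] at this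
  simp at this

/-- Equivariant bijections between nonzero submodules of the fraction field are multiplications by
nonzero elements. -/
lemma nonempty_submodule_iso_iff {H H' : Submodule R K} (hH : H ≠ ⊥) :
    Nonempty (actionAsFunctor R H ≅ actionAsFunctor R H') ↔
      ∃ k : K, k ≠ 0 ∧ ∀ x : K, x ∈ H ↔ k * x ∈ H' := by
  rw [nonempty_actionAsFunctor_iso_iff]
  constructor
  · rintro ⟨e, he⟩
    obtain ⟨h, hh, h0⟩ := H.ne_bot_iff.1 hH
    -- if `x / h = r / s`, then `s • x = r • h`, whence `s • e x = r • e h`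
    have key (x : H) : (e x : K) = e ⟨h, hh⟩ / h * x := by
      obtain ⟨r, s, hs, hrs⟩ := IsFractionRing.div_surjective (A := R) ((x : K) / h)
      have hs0 : algebraMap R K s ≠ 0 := by
        simpa using nonZeroDivisors.ne_zero hs
      have h1 : s • x = r • (⟨h, hh⟩ : H) := by
        ext
        simp only [Submodule.coe_smul, Algebra.smul_def]
        field_simp at hrs
        linear_combination -hrs
      have h2 := congrArg (fun y : H => (e y : K)) h1
      simp only [he, Submodule.coe_smul, Algebra.smul_def] at h2
      field_simp
      field_simp at hrs
      apply mul_left_cancel₀ hs0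
      linear_combination h * h2 + e ⟨h, hh⟩ * hrs
    have he0 : e 0 = 0 := by
      have := he 0 0
      rwa [zero_smul, zero_smul] at this
    have hk : (e ⟨h, hh⟩ / h : K) ≠ 0 := by
      refine div_ne_zero (fun h' => h0 ?_) h0
      have : e ⟨h, hh⟩ = e 0 := by rw [he0]; exact Subtype.ext h'
      exact congrArg Subtype.val (e.injective this)
    refine ⟨e ⟨h, hh⟩ / h, hk, fun x => ⟨fun hx => ?_, fun hx => ?_⟩⟩
    · rw [← key ⟨x, hx⟩]
      exact (e ⟨x, hx⟩).2
    · have := key (e.symm ⟨_, hx⟩)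
      rw [Equiv.apply_symm_apply] at this
      rw [mul_left_cancel₀ hk this]
      exact (e.symm _).2
  · rintro ⟨k, hk, h⟩
    refine ⟨⟨fun x => ⟨k * x, (h x).1 x.2⟩,
      fun y => ⟨k⁻¹ * y, (h _).2 (by rw [mul_inv_cancel_left₀ hk]; exact y.2)⟩,
      fun x => by simp [hk], fun x => by simp [hk]⟩, fun r x => ?_⟩
    ext
    simp

end Domain

/-! ### Points of the topos of `𝓞 K`-sets -/

section Points

variable {K : Type u} [Field K]

instance (p : Point K) : p.inverseImage.IsLeftAdjoint := ⟨_, ⟨p.adj⟩⟩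

instance (p : Point K) : Limits.PreservesFiniteLimits p.inverseImage := p.leftExact

/-- A point is determined by its flat functor. -/
lemma Point.nonempty_inverseImage_iso_iff (p q : Point K) :
    Nonempty (p.inverseImage ≅ q.inverseImage) ↔ Nonempty (p.flatFunctor ≅ q.flatFunctor) :=
  ⟨fun ⟨e⟩ => ⟨Functor.isoWhiskerLeft _ e⟩, fun ⟨e⟩ => nonempty_iso_of_yoneda_comp_iso _ _ e⟩

lemma Point.isNontrivial_iff_of_iso {p : Point K} {H : Submodule (𝓞 K) K}
    (e : p.flatFunctor ≅ moduleFunctor H) : p.IsNontrivial ↔ H ≠ ⊥ := by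
  rw [← Submodule.nontrivial_iff_ne_bot]
  exact (e.app (SingleObj.star (𝓞 K))).toEquiv.nontrivial_congr

/-- The flat functors of trivial points are constant with a one-element value. -/
lemma Point.nonempty_flatFunctor_iso_of_not_isNontrivial {p q : Point K} (hp : ¬ p.IsNontrivial)
    (hq : ¬ q.IsNontrivial) : Nonempty (p.flatFunctor ≅ q.flatFunctor) := by
  have hu (r : Point K) (hr : ¬ r.IsNontrivial) :
      Nonempty (Unique (r.flatFunctor.obj (SingleObj.star (𝓞 K)))) := by
    have : IsCofiltered r.flatFunctor.Elements := isCofiltered_elements_yoneda_comp r.inverseImage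
    obtain ⟨_, x⟩ := IsCofiltered.nonempty (C := r.flatFunctor.Elements)
    have := not_nontrivial_iff_subsingleton.1 hr
    exact ⟨uniqueOfSubsingleton x⟩
  obtain ⟨_⟩ := hu p hp
  obtain ⟨_⟩ := hu q hq
  refine ⟨NatIso.ofComponents (fun _ => (Equiv.ofUnique (p.flatFunctor.obj (SingleObj.star (𝓞 K)))
    (q.flatFunctor.obj (SingleObj.star (𝓞 K)))).toIso) fun {_ _} r => ?_⟩
  ext x
  exact Subsingleton.elim (α := q.flatFunctor.obj (SingleObj.star (𝓞 K))) _ _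

lemma NontrivialPointClass.mk_eq_mk_iff {p q : Point K} (hp : p.IsNontrivial)
    (hq : q.IsNontrivial) : NontrivialPointClass.mk p hp = NontrivialPointClass.mk q hq ↔
      Nonempty (p.flatFunctor ≅ q.flatFunctor) :=
  (Quotient.eq (r := nontrivialPointSetoid K)).trans (Point.nonempty_inverseImage_iso_iff p q)

end Points

/-! ### The modules attached to finite adeles -/

variable {K : Type u} [Field K] [NumberField K]

/-- Over a principal ideal domain the complementary module is generated by one element. -/
lemma exists_complementaryModule_eq_span (K : Type u) [Field K] [NumberField K]
    [IsPrincipalIdealRing (𝓞 K)] :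
    ∃ δ : K, δ ≠ 0 ∧ complementaryModule K = Submodule.span (𝓞 K) {δ} := by
  have hdual : complementaryModule K =
      (FractionalIdeal.dual ℤ ℚ (1 : FractionalIdeal (nonZeroDivisors (𝓞 K)) K) :
        Submodule (𝓞 K) K) := (FractionalIdeal.coe_dual_one ℤ ℚ K (𝓞 K)).symm
  obtain ⟨δ, hδ⟩ := (FractionalIdeal.isPrincipal
    (FractionalIdeal.dual ℤ ℚ (1 : FractionalIdeal (nonZeroDivisors (𝓞 K)) K))).principal
  refine ⟨δ, ?_, hdual.trans hδ⟩
  rintro rfl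
  rw [Submodule.span_zero_singleton] at hδ
  have : (1 : K) ∈ complementaryModule K := by
    apply Submodule.one_le_traceDual_one
    exact Submodule.one_le.1 le_rfl
  rw [hdual, hδ] at this
  simp at this

lemma mem_span_complementaryModule_iff {δ : K} (hδ : δ ≠ 0)
    (h : complementaryModule K = Submodule.span (𝓞 K) {δ}) (𝔭 : HeightOneSpectrum (𝓞 K))
    (x : 𝔭.adicCompletion K) :
    x ∈ Submodule.span (𝔭.adicCompletionIntegers K)
      ((fun q : K => (q : 𝔭.adicCompletion K)) '' (complementaryModule K : Set K)) ↔
      Valued.v x ≤ 𝔭.valuation K δ := by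
  have hδ' : (δ : 𝔭.adicCompletion K) ≠ 0 := by
    rw [← Valuation.ne_zero_iff Valued.v, HeightOneSpectrum.valuedAdicCompletion_eq_valuation']
    exact (Valuation.ne_zero_iff _).2 hδ
  have hspan : Submodule.span (𝔭.adicCompletionIntegers K)
      ((fun q : K => (q : 𝔭.adicCompletion K)) '' (complementaryModule K : Set K)) =
      Submodule.span (𝔭.adicCompletionIntegers K) {(δ : 𝔭.adicCompletion K)} := by
    apply le_antisymm
    · rw [Submodule.span_le]
      rintro _ ⟨q, hq, rfl⟩
      rw [h, SetLike.mem_coe, Submodule.mem_span_singleton] at hq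
      obtain ⟨r, rfl⟩ := hq
      refine Submodule.mem_span_singleton.2 ⟨algebraMap (𝓞 K) _ r, ?_⟩
      rw [Algebra.smul_def, Algebra.smul_def]
      exact (HeightOneSpectrum.adicCompletion.coe_mul _ _ _ _).symm
    · rw [Submodule.span_le, Set.singleton_subset_iff]
      exact Submodule.subset_span ⟨δ, h ▸ Submodule.mem_span_singleton_self δ, rfl⟩
  rw [hspan, Submodule.mem_span_singleton, ← HeightOneSpectrum.valuedAdicCompletion_eq_valuation']
  constructor
  · rintro ⟨r, rfl⟩
    rw [Algebra.smul_def, map_mul]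
    exact mul_le_of_le_one_left' r.2
  · intro hx
    refine ⟨⟨x / δ, ?_⟩, ?_⟩
    · rw [HeightOneSpectrum.mem_adicCompletionIntegers, map_div₀]
      exact div_le_one_of_le₀ hx zero_le
    · rw [Algebra.smul_def]
      exact div_mul_cancel₀ x hδ'

/-- The valuative description of `H_a`, in terms of a generator `δ` of the complementary module. -/
lemma mem_adelicModule_iff {δ : K} (hδ : δ ≠ 0)
    (h : complementaryModule K = Submodule.span (𝓞 K) {δ}) (a : FiniteAdeleRing (𝓞 K) K) (q : K) :
    q ∈ adelicModule a ↔ ∀ 𝔭 : HeightOneSpectrum (𝓞 K),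
      Valued.v (a 𝔭) * 𝔭.valuation K q ≤ 𝔭.valuation K δ := by
  refine forall_congr' fun 𝔭 => (mem_span_complementaryModule_iff hδ h 𝔭 _).trans ?_
  rw [← HeightOneSpectrum.valuedAdicCompletion_eq_valuation' 𝔭 q, ← map_mul]
  rfl

/-- The components of a finite adele have a common denominator, here with respect to `δ`. -/
lemma exists_integral_multiple {δ : K} (hδ : δ ≠ 0) (a : FiniteAdeleRing (𝓞 K) K) :
    ∃ n : 𝓞 K, n ≠ 0 ∧ ∀ 𝔭 : HeightOneSpectrum (𝓞 K),
      Valued.v (a 𝔭) * 𝔭.valuation K (algebraMap (𝓞 K) K n) ≤ 𝔭.valuation K δ := by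
  classical
  have hv (𝔭 : HeightOneSpectrum (𝓞 K)) : 𝔭.valuation K δ ≠ 0 := (Valuation.ne_zero_iff _).2 hδ
  let b : FiniteAdeleRing (𝓞 K) K := a * algebraMap K _ δ⁻¹
  have hb (𝔭 : HeightOneSpectrum (𝓞 K)) :
      Valued.v (b 𝔭) = Valued.v (a 𝔭) * (𝔭.valuation K δ)⁻¹ := by
    rw [← map_inv₀, ← HeightOneSpectrum.valuedAdicCompletion_eq_valuation' 𝔭, ← map_mul]
    rfl
  have hfin : {𝔭 | ¬ b 𝔭 ∈ 𝔭.adicCompletionIntegers K}.Finite := b.2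
  choose n hn0 hn using fun 𝔭 : HeightOneSpectrum (𝓞 K) =>
    HeightOneSpectrum.adicCompletion.mul_nonZeroDivisor_mem_adicCompletionIntegers 𝔭 (b 𝔭)
  have hle (𝔭 : HeightOneSpectrum (𝓞 K)) (r : 𝓞 K) : 𝔭.valuation K (algebraMap (𝓞 K) K r) ≤ 1 :=
    𝔭.valuation_le_one r
  refine ⟨∏ 𝔭 ∈ hfin.toFinset, n 𝔭,
    Finset.prod_ne_zero_iff.2 fun 𝔭 _ => nonZeroDivisors.ne_zero (hn0 𝔭), fun 𝔭 => ?_⟩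
  suffices hs : Valued.v (b 𝔭) * 𝔭.valuation K
      (algebraMap (𝓞 K) K (∏ 𝔭 ∈ hfin.toFinset, n 𝔭)) ≤ 1 by
    rw [hb, mul_right_comm, mul_inv_le_iff₀ (zero_lt_iff.2 (hv 𝔭)), one_mul] at hs
    exact hs
  by_cases hp : b 𝔭 ∈ 𝔭.adicCompletionIntegers K
  · exact mul_le_one' hp (hle _ _)
  · rw [← Finset.mul_prod_erase _ _ (hfin.mem_toFinset.2 hp), map_mul (algebraMap (𝓞 K) K), map_mul,
      ← mul_assoc]
    refine mul_le_one' ?_ (hle _ _)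
    have := (hn 𝔭)
    rw [HeightOneSpectrum.mem_adicCompletionIntegers, map_mul] at this
    convert this using 2
    exact (HeightOneSpectrum.valuedAdicCompletion_eq_valuation' 𝔭 _).symm

/-- At a given prime, the condition defining `H_a` at that prime is the only constraint on the
valuations of the elements of `H_a`: a common denominator for the other primes can be chosen prime
to it. -/
lemma exists_mem_adelicModule_valuation_eq [IsPrincipalIdealRing (𝓞 K)] {δ : K} (hδ : δ ≠ 0)
    (h : complementaryModule K = Submodule.span (𝓞 K) {δ}) (a : FiniteAdeleRing (𝓞 K) K)
    (𝔭 : HeightOneSpectrum (𝓞 K)) (x : K)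
    (hx : Valued.v (a 𝔭) * 𝔭.valuation K x ≤ 𝔭.valuation K δ) :
    ∃ q ∈ adelicModule a, 𝔭.valuation K q = 𝔭.valuation K x := by
  obtain ⟨n, hn, hna⟩ := exists_integral_multiple hδ (a * algebraMap K _ x)
  obtain ⟨π, hπ⟩ := (IsPrincipalIdealRing.principal 𝔭.asIdeal).principal
  rw [Ideal.submodule_span_eq] at hπ
  have hπu : ¬ IsUnit π := fun hu =>
    𝔭.isPrime.ne_top (by rw [hπ, Ideal.span_singleton_eq_top.2 hu])
  obtain ⟨r, hnr, hr⟩ := (FiniteMultiplicity.of_not_isUnit hπu hn).exists_eq_pow_mul_and_not_dvd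
  have hrp : 𝔭.valuation K (algebraMap (𝓞 K) K r) = 1 := by
    rw [HeightOneSpectrum.valuation_eq_one_iff_notMem, hπ, Ideal.mem_span_singleton]
    exact hr
  -- `n` clears the denominators of `a x`; away from `𝔭` its part `r` prime to `𝔭` does so as well
  refine ⟨algebraMap (𝓞 K) K r * x, (mem_adelicModule_iff hδ h a _).2 fun 𝔮 => ?_,
    by rw [map_mul, hrp, one_mul]⟩
  by_cases hq : 𝔮 = 𝔭
  · rw [hq, map_mul, hrp, one_mul]
    exact hx
  · have hπq : 𝔮.valuation K (algebraMap (𝓞 K) K π) = 1 := by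
      rw [HeightOneSpectrum.valuation_eq_one_iff_notMem]
      intro hmem
      have hle : 𝔭.asIdeal ≤ 𝔮.asIdeal := by
        rw [hπ, Ideal.span_singleton_le_iff_mem]
        exact hmem
      exact hq (HeightOneSpectrum.ext (𝔭.isMaximal.eq_of_le 𝔮.isPrime.ne_top hle).symm)
    have := hna 𝔮
    rw [hnr, map_mul (algebraMap (𝓞 K) K), map_pow, map_mul, map_pow, hπq, one_pow, one_mul] at this
    change Valued.v (a 𝔮 * (x : 𝔮.adicCompletion K)) * _ ≤ _ at this
    rw [map_mul, HeightOneSpectrum.valuedAdicCompletion_eq_valuation'] at this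
    rwa [map_mul, mul_comm (𝔮.valuation K (algebraMap (𝓞 K) K r)), ← mul_assoc]

lemma adelicModule_ne_bot {δ : K} (hδ : δ ≠ 0)
    (h : complementaryModule K = Submodule.span (𝓞 K) {δ}) (a : FiniteAdeleRing (𝓞 K) K) :
    adelicModule a ≠ ⊥ := by
  obtain ⟨n, hn, hna⟩ := exists_integral_multiple hδ a
  refine (Submodule.ne_bot_iff _).2
    ⟨algebraMap (𝓞 K) K n, (mem_adelicModule_iff hδ h a _).2 hna, ?_⟩
  simpa using hn

/-- The module `H_a` determines the valuations of the components of `a`, a component being zero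
exactly when the valuations of `H_a` at that prime are unbounded. -/
lemma valued_le_of_adelicModule_le [IsPrincipalIdealRing (𝓞 K)] {δ : K} (hδ : δ ≠ 0)
    (h : complementaryModule K = Submodule.span (𝓞 K) {δ}) {a b : FiniteAdeleRing (𝓞 K) K}
    (hab : adelicModule a ≤ adelicModule b) (𝔭 : HeightOneSpectrum (𝓞 K)) :
    Valued.v (b 𝔭) ≤ Valued.v (a 𝔭) := by
  have hv : 0 < 𝔭.valuation K δ := zero_lt_iff.2 ((Valuation.ne_zero_iff _).2 hδ)
  have key (x : K) (hx : Valued.v (a 𝔭) * 𝔭.valuation K x ≤ 𝔭.valuation K δ) :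
      Valued.v (b 𝔭) * 𝔭.valuation K x ≤ 𝔭.valuation K δ := by
    obtain ⟨q, hq, hqx⟩ := exists_mem_adelicModule_valuation_eq hδ h a 𝔭 x hx
    rw [← hqx]
    exact (mem_adelicModule_iff hδ h b q).1 (hab hq) 𝔭
  rcases eq_or_ne (Valued.v (a 𝔭)) 0 with ha | ha
  · by_contra! hlt
    rw [ha] at hlt
    -- an element of valuation one step beyond the bound imposed by `b`
    obtain ⟨x, hx⟩ := 𝔭.valuation_surjective K
      (𝔭.valuation K δ * WithZero.exp (1 : ℤ) * (Valued.v (b 𝔭))⁻¹)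
    have := key x (by rw [ha, zero_mul]; exact hv.le)
    rw [hx, mul_comm, inv_mul_cancel_right₀ hlt.ne'] at this
    exact absurd this (not_le.2 (lt_mul_of_one_lt_right hv (by simp [← WithZero.exp_zero])))
  · obtain ⟨x, hx⟩ := 𝔭.valuation_surjective K (𝔭.valuation K δ * (Valued.v (a 𝔭))⁻¹)
    have := key x (by rw [hx, mul_comm, inv_mul_cancel_right₀ ha])
    rw [hx, mul_left_comm] at this
    have := le_of_mul_le_mul_left (this.trans_eq (mul_one _).symm) hv
    rwa [mul_inv_le_iff₀ (zero_lt_iff.2 ha), one_mul] at this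

/-- Finite adeles with the same valuations differ by a factor in `∏ 𝓞_𝔭ˣ`, which can be taken to be
`1` wherever both components vanish. -/
lemma exists_unit_mul_eq {a b : FiniteAdeleRing (𝓞 K) K}
    (h : ∀ 𝔭, Valued.v (a 𝔭) = Valued.v (b 𝔭)) :
    ∃ u ∈ integralUnits K, (u : FiniteAdeleRing (𝓞 K) K) * b = a := by
  classical
  let f (𝔭 : HeightOneSpectrum (𝓞 K)) : 𝔭.adicCompletion K := if b 𝔭 = 0 then 1 else a 𝔭 / b 𝔭
  have hf (𝔭 : HeightOneSpectrum (𝓞 K)) : Valued.v (f 𝔭) = 1 := by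
    by_cases hb : b 𝔭 = 0
    · simp only [f, if_pos hb, map_one]
    · simp only [f, if_neg hb, map_div₀, h]
      exact div_self ((Valuation.ne_zero_iff _).2 hb)
  have hf0 (𝔭 : HeightOneSpectrum (𝓞 K)) : f 𝔭 ≠ 0 := by
    rw [← Valuation.ne_zero_iff Valued.v, hf]
    exact one_ne_zero
  have hi (𝔭 : HeightOneSpectrum (𝓞 K)) : f 𝔭 ∈ 𝔭.adicCompletionIntegers K := (hf 𝔭).le
  have hi' (𝔭 : HeightOneSpectrum (𝓞 K)) : (f 𝔭)⁻¹ ∈ 𝔭.adicCompletionIntegers K := by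
    rw [HeightOneSpectrum.mem_adicCompletionIntegers, map_inv₀, hf, inv_one]
  let u : (FiniteAdeleRing (𝓞 K) K)ˣ :=
    { val := ⟨f, Filter.Eventually.of_forall hi⟩
      inv := ⟨fun 𝔭 => (f 𝔭)⁻¹, Filter.Eventually.of_forall hi'⟩
      val_inv := FiniteAdeleRing.ext K fun 𝔭 => mul_inv_cancel₀ (hf0 𝔭)
      inv_val := FiniteAdeleRing.ext K fun 𝔭 => inv_mul_cancel₀ (hf0 𝔭) }
  refine ⟨u, fun 𝔭 => ⟨hi 𝔭, hi' 𝔭⟩, FiniteAdeleRing.ext K fun 𝔭 => ?_⟩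
  change f 𝔭 * b 𝔭 = a 𝔭
  by_cases hb : b 𝔭 = 0
  · have ha : a 𝔭 = 0 := by rw [← Valuation.zero_iff Valued.v, h, hb, map_zero]
    rw [hb, ha, mul_zero]
  · simp only [f, if_neg hb]
    exact div_mul_cancel₀ _ hb

/-- A submodule of `K` is determined by its localizations. -/
lemma mem_of_forall_exists_valuation_le {H : Submodule (𝓞 K) K} {q : K}
    (hq : ∀ 𝔭 : HeightOneSpectrum (𝓞 K), ∃ h ∈ H, 𝔭.valuation K q ≤ 𝔭.valuation K h) :
    q ∈ H := by
  by_contra hqH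
  -- the ideal of the `r` with `r • q ∈ H` lies in no maximal ideal
  let I : Ideal (𝓞 K) := H.comap (LinearMap.toSpanSingleton (𝓞 K) K q)
  have hI : I ≠ ⊤ := by
    rw [Ideal.ne_top_iff_one]
    intro h1
    have h2 : (1 : 𝓞 K) • q ∈ H := h1
    rw [one_smul] at h2
    exact hqH h2
  obtain ⟨M, hM, hIM⟩ := Ideal.exists_le_maximal I hI
  let 𝔭 : HeightOneSpectrum (𝓞 K) := ⟨M, hM.isPrime,
    Ring.ne_bot_of_isMaximal_of_not_isField hM (RingOfIntegers.not_isField K)⟩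
  obtain ⟨h, hh, hqh⟩ := hq 𝔭
  have h0 : h ≠ 0 := by
    rintro rfl
    rw [map_zero, nonpos_iff_eq_zero, Valuation.zero_iff] at hqh
    exact hqH (hqh ▸ H.zero_mem)
  obtain ⟨n, d, hnd⟩ := HeightOneSpectrum.exists_primeCompl_mul_eq_of_integer 𝔭 (q / h) (by
    rw [map_div₀]
    exact div_le_one_of_le₀ hqh zero_le)
  refine d.2 (hIM ?_)
  change (d : 𝓞 K) • q ∈ H
  have : (d : 𝓞 K) • q = n • h := by
    rw [Algebra.smul_def, Algebra.smul_def, ← hnd]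
    field_simp
  rw [this]
  exact H.smul_mem n hh

/-- A nonzero submodule whose valuations at a prime are bounded has an element of largest
valuation. -/
lemma exists_valuation_max {H : Submodule (𝓞 K) K} (hH : H ≠ ⊥) (𝔭 : HeightOneSpectrum (𝓞 K))
    {q : K} (hq : ∀ h ∈ H, 𝔭.valuation K h < 𝔭.valuation K q) :
    ∃ m ∈ H, m ≠ 0 ∧ ∀ h ∈ H, 𝔭.valuation K h ≤ 𝔭.valuation K m := by
  obtain ⟨h₀, hh₀, hne⟩ := H.ne_bot_iff.1 hH
  have hv {h : K} (h0 : h ≠ 0) : 𝔭.valuation K h ≠ 0 := (Valuation.ne_zero_iff _).2 h0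
  obtain ⟨_, ⟨m, hm, hm0, rfl⟩, hmax⟩ := Int.exists_greatest_of_bdd
    (P := fun n => ∃ h ∈ H, h ≠ 0 ∧ WithZero.log (𝔭.valuation K h) = n)
    ⟨WithZero.log (𝔭.valuation K q), by
      rintro _ ⟨h, hh, h0, rfl⟩
      exact (WithZero.log_le_log (hv h0) (zero_le.trans_lt (hq h hh)).ne').2 (hq h hh).le⟩
    ⟨_, h₀, hh₀, hne, rfl⟩
  refine ⟨m, hm, hm0, fun h hh => ?_⟩
  rcases eq_or_ne h 0 with rfl | h0
  · rw [map_zero]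
    exact zero_le
  · exact (WithZero.log_le_log (hv h0) (hv hm0)).1 (hmax _ ⟨h, hh, h0, rfl⟩)

/-- Every nonzero submodule `H` of `K` is some `H_a`: put `a_𝔭 = δ / m_𝔭` with `m_𝔭` an element of
`H` of largest valuation at `𝔭`, and `a_𝔭 = 0` if the valuations of `H` at `𝔭` are unbounded. -/
theorem exists_adelicModule_eq {δ : K} (hδ : δ ≠ 0)
    (h : complementaryModule K = Submodule.span (𝓞 K) {δ}) {H : Submodule (𝓞 K) K} (hH : H ≠ ⊥) :
    ∃ a : FiniteAdeleRing (𝓞 K) K, adelicModule a = H := by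
  classical
  let B (𝔭 : HeightOneSpectrum (𝓞 K)) : Prop :=
    ∃ q : K, ∀ h ∈ H, 𝔭.valuation K h < 𝔭.valuation K q
  have hv (𝔭 : HeightOneSpectrum (𝓞 K)) {x : K} (hx : x ≠ 0) : 0 < 𝔭.valuation K x :=
    zero_lt_iff.2 ((Valuation.ne_zero_iff _).2 hx)
  choose m hm hm0 hmax using fun (𝔭 : HeightOneSpectrum (𝓞 K)) (hB : B 𝔭) =>
    exists_valuation_max hH 𝔭 hB.choose_spec
  let c (𝔭 : HeightOneSpectrum (𝓞 K)) : K := if hB : B 𝔭 then δ / m 𝔭 hB else 0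
  have hc (𝔭 : HeightOneSpectrum (𝓞 K)) {x : K} (hx : x ∈ H) :
      𝔭.valuation K (c 𝔭) * 𝔭.valuation K x ≤ 𝔭.valuation K δ := by
    by_cases hB : B 𝔭
    · simp only [c, dif_pos hB, map_div₀]
      rw [div_mul_eq_mul_div, div_le_iff₀ (hv 𝔭 (hm0 𝔭 hB))]
      exact mul_le_mul_right (hmax 𝔭 hB x hx) _
    · simp [c, dif_neg hB]
  obtain ⟨h₀, hh₀, hne⟩ := H.ne_bot_iff.1 hH
  let a : FiniteAdeleRing (𝓞 K) K := ⟨fun 𝔭 => (c 𝔭 : 𝔭.adicCompletion K), by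
    -- at almost all primes `δ / h₀` is integral
    filter_upwards [(algebraMap K (FiniteAdeleRing (𝓞 K) K) (δ / h₀)).2] with 𝔭 hp
    change _ ∈ 𝔭.adicCompletionIntegers K at hp
    change _ ∈ 𝔭.adicCompletionIntegers K
    rw [HeightOneSpectrum.mem_adicCompletionIntegers,
      HeightOneSpectrum.valuedAdicCompletion_eq_valuation']
    refine le_trans ?_ hp
    change _ ≤ Valued.v ((δ / h₀ : K) : 𝔭.adicCompletion K)
    rw [HeightOneSpectrum.valuedAdicCompletion_eq_valuation', map_div₀,
      le_div_iff₀ (hv 𝔭 hne)]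
    exact hc 𝔭 hh₀⟩
  have ha (𝔭 : HeightOneSpectrum (𝓞 K)) : Valued.v (a 𝔭) = 𝔭.valuation K (c 𝔭) :=
    HeightOneSpectrum.valuedAdicCompletion_eq_valuation' 𝔭 _
  refine ⟨a, SetLike.ext fun q => ?_⟩
  simp only [mem_adelicModule_iff hδ h, ha]
  refine ⟨fun hq => mem_of_forall_exists_valuation_le fun 𝔭 => ?_, fun hq 𝔭 => hc 𝔭 hq⟩
  by_cases hB : B 𝔭
  · refine ⟨m 𝔭 hB, hm 𝔭 hB, ?_⟩
    have := hq 𝔭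
    simp only [c, dif_pos hB, map_div₀] at this
    rw [div_mul_eq_mul_div, div_le_iff₀ (hv 𝔭 (hm0 𝔭 hB))] at this
    exact le_of_mul_le_mul_left this (hv 𝔭 hδ)
  · simp only [B] at hB
    push Not at hB
    exact hB q

lemma adelicModule_integralUnits_mul {δ : K} (hδ : δ ≠ 0)
    (h : complementaryModule K = Submodule.span (𝓞 K) {δ}) (a : FiniteAdeleRing (𝓞 K) K)
    {u : (FiniteAdeleRing (𝓞 K) K)ˣ} (hu : u ∈ integralUnits K) :
    adelicModule ((u : FiniteAdeleRing (𝓞 K) K) * a) = adelicModule a := by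
  have hle (w : (FiniteAdeleRing (𝓞 K) K)ˣ) (hw : w ∈ integralUnits K)
      (b : FiniteAdeleRing (𝓞 K) K) :
      adelicModule b ≤ adelicModule ((w : FiniteAdeleRing (𝓞 K) K) * b) := by
    intro q hq
    rw [mem_adelicModule_iff hδ h] at hq ⊢
    intro 𝔭
    change Valued.v ((w : FiniteAdeleRing (𝓞 K) K) 𝔭 * b 𝔭) * _ ≤ _
    rw [map_mul, mul_assoc]
    exact (mul_le_of_le_one_left' (hw 𝔭).1).trans (hq 𝔭)
  refine le_antisymm ?_ (hle u hu a)
  have := hle u⁻¹ (inv_mem hu) ((u : FiniteAdeleRing (𝓞 K) K) * a)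
  rwa [Units.inv_mul_cancel_left] at this

lemma mem_adelicModule_algebraMap_mul (k : K) (a : FiniteAdeleRing (𝓞 K) K) (q : K) :
    q ∈ adelicModule (algebraMap K _ k * a) ↔ k * q ∈ adelicModule a := by
  change _ * _ ∈ complementaryCompletion K ↔ _ * _ ∈ complementaryCompletion K
  rw [map_mul, mul_left_comm, ← mul_assoc]

/-! ### The classification -/

lemma AdelicQuotient.mk_eq_mk_iff {a b : FiniteAdeleRing (𝓞 K) K} :
    AdelicQuotient.mk a = AdelicQuotient.mk b ↔ ∃ k : K, k ≠ 0 ∧ ∃ u ∈ integralUnits K,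
      (u : FiniteAdeleRing (𝓞 K) K) * (algebraMap K _ k * b) = a := by
  have : AdelicQuotient.mk a = AdelicQuotient.mk b ↔ ∃ g : adelicGroup K, g • b = a :=
    Quotient.eq (r := MulAction.orbitRel (adelicGroup K) (FiniteAdeleRing (𝓞 K) K))
  rw [this]
  constructor
  · rintro ⟨⟨g, hg⟩, rfl⟩
    obtain ⟨_, ⟨k, rfl⟩, u, hu, rfl⟩ := Subgroup.mem_sup.1 hg
    refine ⟨k, k.ne_zero, u, hu, ?_⟩
    change _ = ((_ * u : (FiniteAdeleRing (𝓞 K) K)ˣ) : FiniteAdeleRing (𝓞 K) K) * b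
    rw [Units.val_mul, FiniteAdeleRing.unitEmbedding_apply]
    ring
  · rintro ⟨k, hk, u, hu, rfl⟩
    refine ⟨⟨FiniteAdeleRing.unitEmbedding (𝓞 K) K (Units.mk0 k hk) * u,
      Subgroup.mul_mem_sup ⟨_, rfl⟩ hu⟩, ?_⟩
    change ((_ * u : (FiniteAdeleRing (𝓞 K) K)ˣ) : FiniteAdeleRing (𝓞 K) K) * b = _
    rw [Units.val_mul, FiniteAdeleRing.unitEmbedding_apply, Units.val_mk0]
    ring

/-- The modules `H_a` and `H_b` are isomorphic exactly when `a` and `b` lie in one orbit. -/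
theorem nonempty_moduleFunctor_adelicModule_iso_iff [IsPrincipalIdealRing (𝓞 K)]
    {a b : FiniteAdeleRing (𝓞 K) K} :
    Nonempty (moduleFunctor (adelicModule a) ≅ moduleFunctor (adelicModule b)) ↔
      AdelicQuotient.mk a = AdelicQuotient.mk b := by
  obtain ⟨δ, hδ, h⟩ := exists_complementaryModule_eq_span K
  rw [AdelicQuotient.mk_eq_mk_iff]
  refine (nonempty_submodule_iso_iff (adelicModule_ne_bot hδ h a)).trans
    (exists_congr fun k => and_congr_right fun hk => ?_)
  constructor
  · intro hab
    have heq : adelicModule a = adelicModule (algebraMap K _ k * b) := by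
      ext x
      rw [hab, mem_adelicModule_algebraMap_mul]
    exact exists_unit_mul_eq fun 𝔭 => le_antisymm
      (valued_le_of_adelicModule_le hδ h heq.ge 𝔭) (valued_le_of_adelicModule_le hδ h heq.le 𝔭)
  · rintro ⟨u, hu, rfl⟩ x
    rw [adelicModule_integralUnits_mul hδ h _ hu, mem_adelicModule_algebraMap_mul]

/-- Every submodule of `K` is the flat functor of a point. -/
lemma exists_point_flatFunctor_iso [IsPrincipalIdealRing (𝓞 K)] (H : Submodule (𝓞 K) K) :
    ∃ p : Point K, Nonempty (p.flatFunctor ≅ moduleFunctor H) :=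
  haveI := isCofiltered_elements_submodule H
  ⟨ToposPoint.ofIsCofiltered (actionAsFunctor (𝓞 K) H), ⟨ToposPoint.yonedaCompOfIsCofilteredIso _⟩⟩

/-- The flat functor of a non-trivial point is a nonzero submodule of `K`. -/
lemma Point.IsNontrivial.exists_flatFunctor_iso {p : Point K} (hp : p.IsNontrivial) :
    ∃ H : Submodule (𝓞 K) K, H ≠ ⊥ ∧ Nonempty (p.flatFunctor ≅ moduleFunctor H) := by
  let _ := functorMulAction p.flatFunctor
  have : Nontrivial (p.flatFunctor.obj (SingleObj.star (𝓞 K))) := hp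
  have : IsCofiltered p.flatFunctor.Elements := isCofiltered_elements_yoneda_comp p.inverseImage
  obtain ⟨H, hH, he⟩ := exists_submodule_equiv (K := K)
    (isCofiltered_elements_of_iso (isoActionAsFunctor p.flatFunctor))
  obtain ⟨e⟩ := nonempty_actionAsFunctor_iso_iff.2 he
  exact ⟨H, hH, ⟨isoActionAsFunctor p.flatFunctor ≪≫ e⟩⟩

end OKTopos
end

theorem mainTheorem3 (K : Type*) [Field K] [NumberField K] [IsPrincipalIdealRing (𝓞 K)] :
    (∃ Φ : OKTopos.AdelicQuotient K ≃ OKTopos.NontrivialPointClass K,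
      ∀ (a : FiniteAdeleRing (𝓞 K) K) (p : OKTopos.Point K) (hp : p.IsNontrivial),
        Φ (OKTopos.AdelicQuotient.mk a) = OKTopos.NontrivialPointClass.mk p hp ↔
          Nonempty (p.flatFunctor ≅ OKTopos.moduleFunctor (OKTopos.adelicModule a))) ∧
    (∃ p : OKTopos.Point K, ¬ p.IsNontrivial) ∧
    (∀ p q : OKTopos.Point K, ¬ p.IsNontrivial → ¬ q.IsNontrivial →
      Nonempty (p.inverseImage ≅ q.inverseImage)) := by
  open OKTopos in
  refine ⟨?_, ?_, fun p q hp hq => (Point.nonempty_inverseImage_iso_iff p q).2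
    (Point.nonempty_flatFunctor_iso_of_not_isNontrivial hp hq)⟩
  · obtain ⟨δ, hδ, h⟩ := exists_complementaryModule_eq_span K
    choose P e using fun a : FiniteAdeleRing (𝓞 K) K =>
      exists_point_flatFunctor_iso (adelicModule a)
    have hP (a) : (P a).IsNontrivial :=
      (Point.isNontrivial_iff_of_iso (e a).some).2 (adelicModule_ne_bot hδ h a)
    have hiff (a : FiniteAdeleRing (𝓞 K) K) (p : Point K) (hp : p.IsNontrivial) :
        NontrivialPointClass.mk (P a) (hP a) = NontrivialPointClass.mk p hp ↔
          Nonempty (p.flatFunctor ≅ moduleFunctor (adelicModule a)) :=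
      (NontrivialPointClass.mk_eq_mk_iff _ _).trans
        ⟨fun ⟨i⟩ => ⟨i.symm ≪≫ (e a).some⟩, fun ⟨i⟩ => ⟨(e a).some ≪≫ i.symm⟩⟩
    have hab (a b : FiniteAdeleRing (𝓞 K) K) :
        NontrivialPointClass.mk (P a) (hP a) = NontrivialPointClass.mk (P b) (hP b) ↔
          AdelicQuotient.mk a = AdelicQuotient.mk b := by
      rw [eq_comm, NontrivialPointClass.mk_eq_mk_iff, ← nonempty_moduleFunctor_adelicModule_iso_iff]
      exact ⟨fun ⟨i⟩ => ⟨(e a).some.symm ≪≫ i.symm ≪≫ (e b).some⟩,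
        fun ⟨i⟩ => ⟨(e b).some ≪≫ i.symm ≪≫ (e a).some.symm⟩⟩
    let φ : AdelicQuotient K → NontrivialPointClass K :=
      Quotient.lift (fun a => NontrivialPointClass.mk (P a) (hP a))
        fun a b hr => (hab a b).2 (Quotient.sound hr)
    refine ⟨Equiv.ofBijective φ ⟨?_, ?_⟩, hiff⟩
    · rintro ⟨a⟩ ⟨b⟩ hφ
      exact (hab a b).1 hφ
    · rintro ⟨⟨p, hp⟩⟩
      obtain ⟨H, hH, hpH⟩ := hp.exists_flatFunctor_iso
      obtain ⟨a, rfl⟩ := exists_adelicModule_eq hδ h hH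
      exact ⟨AdelicQuotient.mk a, (hiff a p hp).2 hpH⟩
  · obtain ⟨p, ⟨e⟩⟩ := exists_point_flatFunctor_iso (⊥ : Submodule (𝓞 K) K)
    exact ⟨p, fun hp => (Point.isNontrivial_iff_of_iso e).1 hp rfl⟩
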